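/- Let $G$ be a real, connected, compact, semisimple Lie group (finite-dimensional, Hausdorff, without boundary; semisimple means that its Lie algebra is semisimple). Let $\mathcal{X}$ be a linear vector field on $G$, i.e. a smooth vector field whose flow $(\varphi_t)_{t\in\mathbb{R}}$ consists of Lie group automorphisms of $G$. Then every periodic orbit of $\varphi_t$ is stable. That is, let $\Gamma=\{\varphi_t(g): t\in\mathbb{R}\}$, where $g\in G$ and $\varphi_{t+T}(g)=\varphi_t(g)$ for all $t\in\mathbb{R}$, for some $T>0$ (fixed points are allowed). Then for every open set $V\supseteq\Gamma$ there is an open set $W$ with $\Gamma\subseteq W\subseteq V$ such that every solution $\gamma:\mathbb{R}\to G$ of $\dot\gamma=\mathcal{X}(\gamma)$ with $\gamma(0)\in W$ satisfies $\gamma(t)\in V$ for all $t\ge 0$. -/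

import Mathlib

open Set
open scoped Manifold ContDiff

namespace LinearFlow

section

variable {E : Type*} [NormedAddCommGroup E] [NormedSpace ℝ E]
  {H : Type*} [TopologicalSpace H] (I : ModelWithCorners ℝ E H)
  {G : Type*} [TopologicalSpace G] [ChartedSpace H G]

/-- A smooth real Lie group is of the class `C^3` for which the Lie algebra structure on
`GroupLieAlgebra I G` is set up. -/
instance lieGroup_minSmoothness [Group G] [LieGroup I ∞ G] :
    LieGroup I (minSmoothness ℝ 3) G :=
  LieGroup.of_le (n := ∞) (by
    rw [minSmoothness_of_isRCLikeNormedField]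
    exact ENat.LEInfty.out)

/-- `φ` is the (global) flow of the vector field `X`: for every `g`, the curve `t ↦ φ t g` is the
solution of `ġ = X(g)` with value `g` at time `0`. -/
def IsFlow (X : (g : G) → TangentSpace I g) (φ : ℝ → G → G) : Prop :=
  ∀ g : G, φ 0 g = g ∧ IsMIntegralCurve (I := I) (fun t => φ t g) X

/-- `f` is an automorphism of the Lie group `G`: a group automorphism that is smooth together with
its inverse. -/
def IsLieGroupAutomorphism [Group G] (f : G → G) : Prop :=
  ∃ e : G ≃* G, (∀ g, e g = f g) ∧ ContMDiff I I ∞ e ∧ ContMDiff I I ∞ e.symm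

/-- A linear vector field on a Lie group: a smooth vector field whose flow `(φ t)`, `t ∈ ℝ`,
consists of automorphisms of the Lie group. -/
structure IsLinearVectorField [Group G] [LieGroup I ∞ G] (X : (g : G) → TangentSpace I g) :
    Prop where
  contMDiff : ContMDiff I I.tangent ∞ (fun g : G => (⟨g, X g⟩ : TangentBundle I G))
  exists_flow : ∃ φ : ℝ → G → G, IsFlow I X φ ∧ ∀ t, IsLieGroupAutomorphism I (φ t)

/-- A set `Γ` is stable for `ġ = X(g)`: every open `V ⊇ Γ` contains an open `W ⊇ Γ` such that each
solution starting in `W` at time `0` stays in `V` for all `t ≥ 0`. -/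
def IsStableOrbit (X : (g : G) → TangentSpace I g) (Γ : Set G) : Prop :=
  ∀ V : Set G, IsOpen V → Γ ⊆ V → ∃ W : Set G, IsOpen W ∧ Γ ⊆ W ∧ W ⊆ V ∧
    ∀ γ : ℝ → G, IsMIntegralCurve (I := I) γ X → γ 0 ∈ W → ∀ t : ℝ, 0 ≤ t → γ t ∈ V

end

/-- `Γ` is a periodic orbit of the flow `φ`: the orbit of a point `g` for which `t ↦ φ t g` has a
period `T > 0`. (Fixed points, which have every period, are included.) -/
def IsPeriodicOrbit {G : Type*} (φ : ℝ → G → G) (Γ : Set G) : Prop :=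
  ∃ g : G, (∃ T : ℝ, 0 < T ∧ ∀ t : ℝ, φ (t + T) g = φ t g) ∧ Γ = range (fun t => φ t g)

end LinearFlow

/-! The function `g ↦ tr (Ad g)` is a first integral of every flow of automorphisms, since an
automorphism `e` conjugates `Ad g` into `Ad (e g)` (`trace_Ad_apply_of_automorphism`). By
compactness `Ad` preserves an inner product (`exists_invariant_form`), so the trace is at most the
dimension, with equality only when `Ad g = id` (`trace_le_and_eq_id_of_isometry`). Semisimplicity
makes the centre of the Lie algebra trivial. As the derivative of `Ad` at `1` is the bracket, `Ad g
= id` then forces `g = 1` near `1` (`eventually_eq_one_of_Ad_eq_id`). The trace thus has a strict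
local maximum at `1`, and `1` is stable by a Lyapunov argument. Finally `φ t (x * w) = φ t x * φ t
w` carries stability at `1` over to any compact invariant set, in particular to a periodic orbit. -/

namespace LinearFlow

open Filter Topology

/-! ### The adjoint representation and its trace -/

section Adjoint

variable {E : Type*} [NormedAddCommGroup E] [NormedSpace ℝ E]
  {H : Type*} [TopologicalSpace H] (I : ModelWithCorners ℝ E H)
  {G : Type*} [TopologicalSpace G] [ChartedSpace H G]

/-- The derivative of a self-map of a manifold, as an endomorphism of the model space. -/
noncomputable def tderiv (f : G → G) (x : G) : E →L[ℝ] E := mfderiv I I f x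

variable {I}

theorem tderiv_comp {f g : G → G} {x y : G} (hf : MDifferentiableAt I I f y)
    (hg : MDifferentiableAt I I g x) (hy : g x = y) :
    tderiv I (fun z => f (g z)) x = (tderiv I f y).comp (tderiv I g x) := by
  subst hy
  exact mfderiv_comp x hf hg

theorem tderiv_id (x : G) : tderiv I (fun z : G => z) x = ContinuousLinearMap.id ℝ E :=
  mfderiv_id

variable [Group G]

variable (I) in
/-- The adjoint representation of a Lie group on its tangent space at `1`. -/
noncomputable def Ad (g : G) : E →L[ℝ] E := tderiv I (fun x : G => g * x * g⁻¹) 1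

theorem Ad_one : Ad I (1 : G) = ContinuousLinearMap.id ℝ E := by
  simp only [Ad, one_mul, inv_one, mul_one]
  exact tderiv_id 1

theorem tderiv_symm_comp (e : G ≃* G) (he : MDifferentiable I I e)
    (he' : MDifferentiable I I e.symm) :
    (tderiv I e.symm 1).comp (tderiv I e 1) = ContinuousLinearMap.id ℝ E := by
  rw [← tderiv_comp (he' 1) (he 1) (by simp), ← tderiv_id (I := I) (1 : G)]
  congr 1
  ext x
  simp

theorem tderiv_comp_symm (e : G ≃* G) (he : MDifferentiable I I e)
    (he' : MDifferentiable I I e.symm) :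
    (tderiv I e 1).comp (tderiv I e.symm 1) = ContinuousLinearMap.id ℝ E :=
  tderiv_symm_comp e.symm he' he

variable [LieGroup I ∞ G]

theorem mdifferentiable_mul_left' (g : G) : MDifferentiable I I (fun x : G => g * x) :=
  (contMDiff_mul_left (n := ∞)).mdifferentiable (by simp)

theorem mdifferentiable_mul_right' (g : G) : MDifferentiable I I (fun x : G => x * g) :=
  (contMDiff_mul_right (n := ∞)).mdifferentiable (by simp)

theorem mdifferentiable_conj (g : G) : MDifferentiable I I (fun x : G => g * x * g⁻¹) :=
  (mdifferentiable_mul_right' g⁻¹).comp (mdifferentiable_mul_left' g)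

theorem Ad_mul (g h : G) : Ad I (g * h) = (Ad I g).comp (Ad I h) := by
  rw [Ad, Ad, Ad, ← tderiv_comp (mdifferentiable_conj g 1) (mdifferentiable_conj h 1) (by simp)]
  congr 1
  ext x
  group

theorem tderiv_mul_left_eq (g : G) :
    tderiv I (fun x : G => g * x) 1 = (tderiv I (fun x : G => x * g) 1).comp (Ad I g) := by
  rw [Ad, ← tderiv_comp (mdifferentiable_mul_right' g 1) (mdifferentiable_conj g 1) (by simp)]
  congr 1
  ext x
  group

/-- An automorphism `e` intertwines `Ad g` and `Ad (e g)`. -/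
theorem tderiv_comp_Ad (e : G ≃* G) (he : MDifferentiable I I e) (g : G) :
    (tderiv I e 1).comp (Ad I g) = (Ad I (e g)).comp (tderiv I e 1) := by
  rw [Ad, Ad, ← tderiv_comp (he 1) (mdifferentiable_conj g 1) (by simp),
    ← tderiv_comp (mdifferentiable_conj (e g) 1) (he 1) (by simp)]
  congr 1
  ext x
  simp

/-- The trace of the adjoint representation is invariant under Lie group automorphisms. -/
theorem trace_Ad_apply_of_automorphism [FiniteDimensional ℝ E] {f : G → G} (hf : IsLieGroupAutomorphism I f) (g : G) :
    LinearMap.trace ℝ E (Ad I (f g) : E →ₗ[ℝ] E) = LinearMap.trace ℝ E (Ad I g : E →ₗ[ℝ] E) := by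
  obtain ⟨e, he, h1, h2⟩ := hf
  have d1 : MDifferentiable I I e := h1.mdifferentiable (by simp)
  have d2 : MDifferentiable I I e.symm := h2.mdifferentiable (by simp)
  have key : (Ad I (f g) : E →ₗ[ℝ] E)
      = (tderiv I e 1 : E →ₗ[ℝ] E) ∘ₗ ((Ad I g : E →ₗ[ℝ] E) ∘ₗ (tderiv I e.symm 1 : E →ₗ[ℝ] E)) := by
    have := tderiv_comp_Ad e d1 g
    have h3 := tderiv_comp_symm e d1 d2
    rw [← he g]
    ext v
    have h4 := DFunLike.congr_fun this (tderiv I e.symm 1 v)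
    have h5 := DFunLike.congr_fun h3 v
    simp only [ContinuousLinearMap.comp_apply, ContinuousLinearMap.id_apply] at h4 h5
    simp [h4, h5]
  rw [key, LinearMap.trace_comp_comm', LinearMap.comp_assoc]
  have h6 : (tderiv I e.symm 1 : E →ₗ[ℝ] E) ∘ₗ (tderiv I e 1 : E →ₗ[ℝ] E) = LinearMap.id := by
    ext v
    exact DFunLike.congr_fun (tderiv_symm_comp e d1 d2) v
  rw [h6, LinearMap.comp_id]

end Adjoint

/-! ### Derivatives read in the chart at the identity -/

section Chart

variable {E : Type*} [NormedAddCommGroup E] [NormedSpace ℝ E]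
  {H : Type*} [TopologicalSpace H] (I : ModelWithCorners ℝ E H)
  (G : Type*) [TopologicalSpace G] [ChartedSpace H G] [Group G]

/-- The derivative of the chart at `1`, as an endomorphism of the model space. -/
noncomputable def chartDeriv (g : G) : E →L[ℝ] E := mfderiv I 𝓘(ℝ, E) (extChartAt I (1 : G)) g

/-- The multiplication of `G` read in the chart at `1`. -/
noncomputable def chartMul (p : E × E) : E :=
  extChartAt I (1 : G) ((extChartAt I (1 : G)).symm p.1 * (extChartAt I (1 : G)).symm p.2)

variable {I G}

theorem extChartAt_one_target_mem_nhds [BoundarylessManifold I G] :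
    (extChartAt I (1 : G)).target ∈ 𝓝 (extChartAt I (1 : G) 1) :=
  mem_interior_iff_mem_nhds.1
    (I.isInteriorPoint_iff.1 (BoundarylessManifold.isInteriorPoint (I := I) (x := (1 : G))))

theorem range_mem_nhds_extChartAt [BoundarylessManifold I G] :
    range I ∈ 𝓝 (extChartAt I (1 : G) 1) :=
  mem_of_superset extChartAt_one_target_mem_nhds (extChartAt_target_subset_range 1)

variable [LieGroup I ∞ G]

theorem chartDeriv_one : chartDeriv I G 1 = ContinuousLinearMap.id ℝ E :=
  have : IsManifold I 1 G := IsManifold.of_le (n := ∞) (by simp)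
  mfderiv_extChartAt_self

variable [BoundarylessManifold I G]

theorem hasMFDerivAt_extChartAt_symm :
    HasMFDerivAt 𝓘(ℝ, E) I (extChartAt I (1 : G)).symm (extChartAt I (1 : G) 1)
      (ContinuousLinearMap.id ℝ E) := by
  have : IsManifold I 1 G := IsManifold.of_le (n := ∞) (by simp)
  have h1 : MDifferentiableAt 𝓘(ℝ, E) I (extChartAt I (1 : G)).symm (extChartAt I (1 : G) 1) :=
    ((contMDiffOn_extChartAt_symm (n := 1) (I := I) (1 : G)).contMDiffAt
      extChartAt_one_target_mem_nhds).mdifferentiableAt (by simp)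
  have h2 := h1.hasMFDerivAt
  have h3 := mfderivWithin_range_extChartAt_symm (I := I) (x := (1 : G))
  rw [mfderivWithin_of_mem_nhds range_mem_nhds_extChartAt] at h3
  rw [h3] at h2
  exact h2

theorem hasFDerivAt_chart_comp {f : G → G} (hf : MDifferentiableAt I I f 1) {y : G} (hy : f 1 = y)
    (hys : y ∈ (extChartAt I (1 : G)).source) :
    HasFDerivAt (fun z => extChartAt I (1 : G) (f ((extChartAt I (1 : G)).symm z)))
      ((chartDeriv I G y).comp (tderiv I f 1)) (extChartAt I (1 : G) 1) := by
  have : IsManifold I 1 G := IsManifold.of_le (n := ∞) (by simp)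
  subst hy
  have e1 : (extChartAt I (1 : G)).symm (extChartAt I (1 : G) 1) = 1 := extChartAt_to_inv 1
  have hψ : HasMFDerivAt I 𝓘(ℝ, E) (extChartAt I (1 : G)) (f 1)
      (chartDeriv (E := E) I G (f 1)) :=
    (mdifferentiableAt_extChartAt (by simpa using hys)).hasMFDerivAt
  have hf' : HasMFDerivAt I I f 1 (tderiv (E := E) I f 1) := hf.hasMFDerivAt
  have h := hψ.comp (1 : G) hf'
  have h2 := HasMFDerivAt.comp (I' := I) (extChartAt I (1 : G) 1) (g := extChartAt I (1 : G) ∘ f)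
    (by rw [e1]; exact h)
    (hasMFDerivAt_extChartAt_symm (I := I) (G := G))
  exact h2.hasFDerivAt

end Chart

/-! ### The derivative of `Ad` at the identity is the Lie bracket -/

section Bracket

variable {E : Type*} [NormedAddCommGroup E] [NormedSpace ℝ E]
  {H : Type*} [TopologicalSpace H] {I : ModelWithCorners ℝ E H}
  {G : Type*} [TopologicalSpace G] [ChartedSpace H G] [Group G] [LieGroup I ∞ G]
  [BoundarylessManifold I G]

theorem contDiffAt_chartMul :
    ContDiffAt ℝ 3 (chartMul I G) (extChartAt I (1 : G) 1, extChartAt I (1 : G) 1) := by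
  have : IsManifold I ∞ G := inferInstance
  have hσ : ContMDiffAt 𝓘(ℝ, E) I ∞ (extChartAt I (1 : G)).symm (extChartAt I (1 : G) 1) :=
    (contMDiffOn_extChartAt_symm (1 : G)).contMDiffAt extChartAt_one_target_mem_nhds
  have e1 : (extChartAt I (1 : G)).symm (extChartAt I (1 : G) 1) = 1 := extChartAt_to_inv 1
  have h1 : ContMDiffAt 𝓘(ℝ, E × E) I ∞ (fun p : E × E => (extChartAt I (1 : G)).symm p.1)
      (extChartAt I (1 : G) 1, extChartAt I (1 : G) 1) :=
    ContMDiffAt.comp (I' := 𝓘(ℝ, E)) _ hσ contDiff_fst.contMDiff.contMDiffAt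
  have h2 : ContMDiffAt 𝓘(ℝ, E × E) I ∞ (fun p : E × E => (extChartAt I (1 : G)).symm p.2)
      (extChartAt I (1 : G) 1, extChartAt I (1 : G) 1) :=
    ContMDiffAt.comp (I' := 𝓘(ℝ, E)) _ hσ contDiff_snd.contMDiff.contMDiffAt
  have h3 := h1.mul h2
  have h4 : ContMDiffAt I 𝓘(ℝ, E) ∞ (extChartAt I (1 : G)) 1 := contMDiffAt_extChartAt
  have h5 : ContMDiffAt 𝓘(ℝ, E × E) 𝓘(ℝ, E) ∞ (chartMul I G)
      (extChartAt I (1 : G) 1, extChartAt I (1 : G) 1) := by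
    refine ContMDiffAt.comp (I' := I) _ ?_ h3
    simp only [e1, mul_one]
    exact h4
  exact (contMDiffAt_iff_contDiffAt.1 h5).of_le (by exact ENat.LEInfty.out)

variable (I G) in
/-- Left translations read in the chart at `1`: their derivative at `1`. -/
noncomputable def chartLeft (x : E) : E →L[ℝ] E :=
  (fderiv ℝ (chartMul I G) (x, extChartAt I (1 : G) 1)).comp (ContinuousLinearMap.inr ℝ E E)

variable (I G) in
/-- Right translations read in the chart at `1`: their derivative at `1`. -/
noncomputable def chartRight (x : E) : E →L[ℝ] E :=
  (fderiv ℝ (chartMul I G) (extChartAt I (1 : G) 1, x)).comp (ContinuousLinearMap.inl ℝ E E)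

variable (I G) in
/-- The second derivative of the multiplication at `(1, 1)`, in the chart at `1`. -/
noncomputable def chartHess : E × E →L[ℝ] E × E →L[ℝ] E :=
  fderiv ℝ (fderiv ℝ (chartMul I G)) (extChartAt I (1 : G) 1, extChartAt I (1 : G) 1)

theorem chartHess_comm (p q : E × E) : chartHess I G p q = chartHess I G q p :=
  (contDiffAt_chartMul (I := I) (G := G)).isSymmSndFDerivAt
    (by rw [minSmoothness_of_isRCLikeNormedField]; norm_num) p q

theorem eventually_differentiableAt_chartMul :
    ∀ᶠ p in 𝓝 (extChartAt I (1 : G) 1, extChartAt I (1 : G) 1),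
      DifferentiableAt ℝ (chartMul I G) p := by
  filter_upwards [(contDiffAt_chartMul (I := I) (G := G)).eventually (by decide)] with p hp
  exact hp.differentiableAt (by simp)

theorem hasFDerivAt_fderiv_chartMul :
    HasFDerivAt (fderiv ℝ (chartMul I G)) (chartHess I G)
      (extChartAt I (1 : G) 1, extChartAt I (1 : G) 1) :=
  (((contDiffAt_chartMul (I := I) (G := G)).fderiv_right (m := 2) (by norm_num)).differentiableAt
    (by simp)).hasFDerivAt

theorem hasFDerivAt_chartLeft :
    HasFDerivAt (chartLeft I G) (((ContinuousLinearMap.inr ℝ E E).precomp E).comp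
      ((chartHess I G).comp (ContinuousLinearMap.inl ℝ E E))) (extChartAt I (1 : G) 1) := by
  have h := (hasFDerivAt_fderiv_chartMul (I := I) (G := G)).comp (extChartAt I (1 : G) 1)
    (f := fun x => (x, extChartAt I (1 : G) 1)) (hasFDerivAt_prodMk_left (extChartAt I (1 : G) 1) (extChartAt I (1 : G) 1))
  exact ((ContinuousLinearMap.inr ℝ E E).precomp E).hasFDerivAt.comp _ h

theorem hasFDerivAt_chartRight :
    HasFDerivAt (chartRight I G) (((ContinuousLinearMap.inl ℝ E E).precomp E).comp
      ((chartHess I G).comp (ContinuousLinearMap.inr ℝ E E))) (extChartAt I (1 : G) 1) := by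
  have h := (hasFDerivAt_fderiv_chartMul (I := I) (G := G)).comp (extChartAt I (1 : G) 1)
    (hasFDerivAt_prodMk_right (extChartAt I (1 : G) 1) (extChartAt I (1 : G) 1))
  exact ((ContinuousLinearMap.inl ℝ E E).precomp E).hasFDerivAt.comp _ h

theorem eventually_chartLeft_eq :
    ∀ᶠ x in 𝓝 (extChartAt I (1 : G) 1), chartLeft I G x =
      (chartDeriv I G ((extChartAt I (1 : G)).symm x)).comp
        (tderiv I (fun z : G => (extChartAt I (1 : G)).symm x * z) 1) := by
  have h1 : Tendsto (fun x : E => (x, extChartAt I (1 : G) 1)) (𝓝 (extChartAt I (1 : G) 1))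
      (𝓝 (extChartAt I (1 : G) 1, extChartAt I (1 : G) 1)) :=
    (Continuous.prodMk_left _).tendsto _
  filter_upwards [h1.eventually (eventually_differentiableAt_chartMul (I := I) (G := G)),
    extChartAt_one_target_mem_nhds] with x hx hxt
  have h2 := hx.hasFDerivAt.comp (extChartAt I (1 : G) 1)
    (hasFDerivAt_prodMk_right x (extChartAt I (1 : G) 1))
  exact h2.unique (hasFDerivAt_chart_comp (mdifferentiable_mul_left' _ 1) (mul_one _)
    ((extChartAt I (1 : G)).map_target hxt))

theorem eventually_chartRight_eq :
    ∀ᶠ x in 𝓝 (extChartAt I (1 : G) 1), chartRight I G x =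
      (chartDeriv I G ((extChartAt I (1 : G)).symm x)).comp
        (tderiv I (fun z : G => z * (extChartAt I (1 : G)).symm x) 1) := by
  have h1 : Tendsto (fun x : E => (extChartAt I (1 : G) 1, x)) (𝓝 (extChartAt I (1 : G) 1))
      (𝓝 (extChartAt I (1 : G) 1, extChartAt I (1 : G) 1)) :=
    (Continuous.prodMk_right _).tendsto _
  filter_upwards [h1.eventually (eventually_differentiableAt_chartMul (I := I) (G := G)),
    extChartAt_one_target_mem_nhds] with x hx hxt
  have h2 := hx.hasFDerivAt.comp (extChartAt I (1 : G) 1)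
    (f := fun y => (y, x)) (hasFDerivAt_prodMk_left (extChartAt I (1 : G) 1) x)
  exact h2.unique (hasFDerivAt_chart_comp (mdifferentiable_mul_right' _ 1) (one_mul _)
    ((extChartAt I (1 : G)).map_target hxt))

theorem chartLeft_base :
    chartLeft I G (extChartAt I (1 : G) 1) = ContinuousLinearMap.id ℝ E := by
  have h := (eventually_chartLeft_eq (I := I) (G := G)).self_of_nhds
  rw [h, extChartAt_to_inv, chartDeriv_one]
  simp only [one_mul]
  exact tderiv_id 1

theorem chartRight_base :
    chartRight I G (extChartAt I (1 : G) 1) = ContinuousLinearMap.id ℝ E := by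
  have h := (eventually_chartRight_eq (I := I) (G := G)).self_of_nhds
  rw [h, extChartAt_to_inv, chartDeriv_one]
  simp only [mul_one]
  exact tderiv_id 1

/-- Left and right translation by the same element end at the same point, so both carry the same
factor `chartDeriv` and `tderiv_mul_left_eq` persists in the chart. -/
theorem eventually_chartRight_comp_Ad :
    ∀ᶠ x in 𝓝 (extChartAt I (1 : G) 1),
      (chartRight I G x).comp (Ad I ((extChartAt I (1 : G)).symm x)) = chartLeft I G x := by
  filter_upwards [eventually_chartLeft_eq (I := I) (G := G),
    eventually_chartRight_eq (I := I) (G := G)] with x hl hr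
  rw [hl, hr, tderiv_mul_left_eq, ContinuousLinearMap.comp_assoc]

/-- In the chart at `1`, the adjoint representation has derivative `v ↦ ⁅v, ·⁆` at `1`. -/
theorem exists_hasFDerivAt_Ad [CompleteSpace E] : ∃ A : E →L[ℝ] E →L[ℝ] E,
    HasFDerivAt (fun x => Ad I ((extChartAt I (1 : G)).symm x)) A (extChartAt I (1 : G) 1) ∧
    ∀ v w, A v w = chartHess I G (v, 0) (0, w) - chartHess I G (w, 0) (0, v) := by
  have hR := hasFDerivAt_chartRight (I := I) (G := G)
  have hL := hasFDerivAt_chartLeft (I := I) (G := G)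
  -- Near the base point `Ad = R⁻¹ L`, with `R`, `L` the chart translations. Both are the identity
  -- at the base point, so the derivative is `L' - R'`.
  have hinv : HasFDerivAt Ring.inverse
      (-ContinuousLinearMap.mulLeftRight ℝ (E →L[ℝ] E) ↑(1 : (E →L[ℝ] E)ˣ)⁻¹ ↑(1 : (E →L[ℝ] E)ˣ)⁻¹)
      (chartRight I G (extChartAt I (1 : G) 1)) := by
    rw [chartRight_base]
    exact hasFDerivAt_ringInverse (𝕜 := ℝ) (1 : (E →L[ℝ] E)ˣ)
  have hP := (hinv.comp _ hR).clm_comp hL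
  have hunit : ∀ᶠ x in 𝓝 (extChartAt I (1 : G) 1), IsUnit (chartRight I G x) := by
    refine hR.continuousAt.eventually (Units.isOpen.mem_nhds ?_)
    rw [chartRight_base]
    exact isUnit_one
  refine ⟨_, hP.congr_of_eventuallyEq ?_, ?_⟩
  · filter_upwards [hunit, eventually_chartRight_comp_Ad (I := I) (G := G)] with x hx hx'
    simp only [Function.comp_apply]
    rw [← hx', ← ContinuousLinearMap.comp_assoc, ← ContinuousLinearMap.mul_def (Ring.inverse _),
      Ring.inverse_mul_cancel _ hx]
    rfl
  · intro v w
    have hb : chartLeft I G (extChartAt I (1 : G) 1) = 1 := chartLeft_base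
    have hb' : chartRight I G (extChartAt I (1 : G) 1) = 1 := chartRight_base
    -- `R'` produces the Hessian on `(0, v)`, `(w, 0)`; symmetry matches the order in the statement.
    rw [chartHess_comm (w, 0) (0, v), Function.comp_apply, hb, hb', Ring.inverse_one]
    simp [sub_eq_add_neg]

theorem eventually_mpullback_mulInvariantVectorField (v : GroupLieAlgebra I G) :
    VectorField.mpullbackWithin 𝓘(ℝ, E) I (extChartAt I (1 : G)).symm
      (mulInvariantVectorField v) (range I) =ᶠ[𝓝 (extChartAt I (1 : G) 1)]
    fun x => chartLeft I G x v := by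
  have : IsManifold I 1 G := IsManifold.of_le (n := ∞) (by simp)
  filter_upwards [eventually_chartLeft_eq (I := I) (G := G),
    extChartAt_one_target_mem_nhds] with x hl hx
  have h1 := mfderiv_extChartAt_comp_mfderivWithin_extChartAt_symm (I := I) hx
  have h2 := mfderivWithin_extChartAt_symm_comp_mfderiv_extChartAt (I := I) hx
  rw [VectorField.mpullbackWithin_apply, ContinuousLinearMap.inverse_eq h2 h1, hl]
  rfl

/-- In the chart, the left-invariant field of `v` is `x ↦ chartLeft I G x v`, so the bracket of
fields at the base point only involves the first derivative of `chartLeft`, a block of the Hessian.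
-/
theorem lie_eq_chartHess (v w : GroupLieAlgebra I G) :
    ⁅v, w⁆ = (chartHess I G (v, 0) (0, w) - chartHess I G (w, 0) (0, v) : E) := by
  have : IsManifold I 1 G := IsManifold.of_le (n := ∞) (by simp)
  have hD : ∀ w : E, HasFDerivAt (fun x => chartLeft I G x w)
      ((chartHess I G).comp (ContinuousLinearMap.inl ℝ E E) |>.flip (0, w))
      (extChartAt I (1 : G) 1) := fun w =>
    ((ContinuousLinearMap.apply ℝ E w).hasFDerivAt.comp _
      (hasFDerivAt_chartLeft (I := I) (G := G)))
  rw [GroupLieAlgebra.bracket_def, ← VectorField.mlieBracketWithin_univ,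
    VectorField.mlieBracketWithin_apply, preimage_univ, univ_inter,
    (eventually_mpullback_mulInvariantVectorField v).lieBracketWithin_vectorField_eq_nhds
      (eventually_mpullback_mulInvariantVectorField w),
    VectorField.lieBracketWithin_of_mem_nhds range_mem_nhds_extChartAt,
    VectorField.lieBracket_eq]
  simp only [(hD v).fderiv, (hD w).fderiv]
  rw [chartLeft_base, mfderiv_extChartAt_self]
  exact DFunLike.congr_fun (ContinuousLinearMap.inverse_id (R := ℝ) (M := E))
    (chartHess I G (v, 0) (0, w) - chartHess I G (w, 0) (0, v))

end Bracket

theorem eq_zero_of_forall_lie_eq_zero {L : Type*} [LieRing L] [LieAlgebra ℝ L]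
    [LieAlgebra.IsSemisimple ℝ L] {v : L} (h : ∀ w : L, ⁅v, w⁆ = 0) : v = 0 := by
  have hv : v ∈ LieAlgebra.center ℝ L :=
    (LieModule.mem_maxTrivSubmodule ℝ L L v).2 fun w => by rw [← lie_skew, h w, neg_zero]
  rwa [LieAlgebra.center_eq_bot, LieSubmodule.mem_bot] at hv

/-! ### Continuity of `Ad` and its local kernel -/

section AdjointTopology

variable {E : Type*} [NormedAddCommGroup E] [NormedSpace ℝ E]
  {H : Type*} [TopologicalSpace H] {I : ModelWithCorners ℝ E H}
  {G : Type*} [TopologicalSpace G] [ChartedSpace H G] [Group G] [LieGroup I ∞ G]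
  [BoundarylessManifold I G]

theorem continuousAt_Ad_one [CompleteSpace E] : ContinuousAt (Ad I : G → E →L[ℝ] E) 1 := by
  obtain ⟨A, hA, -⟩ := exists_hasFDerivAt_Ad (I := I) (G := G)
  have h1 : ContinuousAt (extChartAt I (1 : G)) 1 := continuousAt_extChartAt 1
  refine (ContinuousAt.comp hA.continuousAt h1).congr ?_
  filter_upwards [extChartAt_source_mem_nhds (I := I) (1 : G)] with g hg
  simp only [Function.comp_apply, (extChartAt I (1 : G)).left_inv hg]

theorem continuous_Ad [CompleteSpace E] : Continuous (Ad I : G → E →L[ℝ] E) := by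
  have : IsTopologicalGroup G := topologicalGroup_of_lieGroup I ∞
  refine continuous_iff_continuousAt.2 fun g => ?_
  have h1 : ContinuousAt (fun x : G => Ad I (g⁻¹ * x)) g := by
    refine ContinuousAt.comp (g := (Ad I : G → E →L[ℝ] E)) ?_
      (continuous_const_mul g⁻¹).continuousAt
    rw [inv_mul_cancel]
    exact continuousAt_Ad_one
  have h2 : ContinuousAt (fun x : G => (Ad I g).comp (Ad I (g⁻¹ * x))) g :=
    continuousAt_const.clm_comp h1
  refine h2.congr (Eventually.of_forall fun x => ?_)
  simp only [← Ad_mul, mul_inv_cancel_left]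

/-- If the Lie algebra is semisimple, the adjoint representation is nontrivial on elements
different from `1` which are close to `1`. -/
theorem eventually_eq_one_of_Ad_eq_id [FiniteDimensional ℝ E]
    [LieAlgebra.IsSemisimple ℝ (GroupLieAlgebra I G)] :
    ∀ᶠ g in 𝓝 (1 : G), Ad I g = ContinuousLinearMap.id ℝ E → g = 1 := by
  have : CompleteSpace E := FiniteDimensional.complete ℝ E
  obtain ⟨A, hA, hA'⟩ := exists_hasFDerivAt_Ad (I := I) (G := G)
  have hker : LinearMap.ker (A : E →ₗ[ℝ] E →L[ℝ] E) = ⊥ := by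
    refine LinearMap.ker_eq_bot'.2 fun v hv => ?_
    have hv' : A v = 0 := hv
    refine eq_zero_of_forall_lie_eq_zero (L := GroupLieAlgebra I G) fun w => ?_
    exact (lie_eq_chartHess (I := I) (G := G) v w).trans
      ((hA' v w).symm.trans (by rw [hv']; rfl))
  -- An injective derivative in finite dimension is bounded below, so `Ad` avoids the value `id` on
  -- a punctured neighbourhood.
  obtain ⟨K, -, hK⟩ := LinearMap.exists_antilipschitzWith (A : E →ₗ[ℝ] E →L[ℝ] E) hker
  have h1 := hA.eventually_ne ⟨K, hK⟩ (c := ContinuousLinearMap.id ℝ E)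
  rw [eventually_nhdsWithin_iff] at h1
  have h2 : ContinuousAt (extChartAt I (1 : G)) 1 := continuousAt_extChartAt 1
  filter_upwards [h2.eventually h1, extChartAt_source_mem_nhds (I := I) (1 : G)] with g hg hs hAd
  by_contra hne
  refine hg (fun h => hne ?_) ?_
  · exact (extChartAt I (1 : G)).injOn hs (mem_extChartAt_source 1) h
  · rw [(extChartAt I (1 : G)).left_inv hs, hAd]

end AdjointTopology

/-! ### Traces of isometries -/

section Trace

variable {E : Type*} [AddCommGroup E] [Module ℝ E] [FiniteDimensional ℝ E]

/-- The trace of an isometry of an inner product is at most the dimension, with equality only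
for the identity. -/
theorem trace_le_and_eq_id_of_isometry (B : LinearMap.BilinForm ℝ E) (hs : LinearMap.IsSymm B)
    (hp : ∀ v, v ≠ 0 → 0 < B v v) (M : E →ₗ[ℝ] E) (hM : ∀ u v, B (M u) (M v) = B u v) :
    LinearMap.trace ℝ E M ≤ Module.finrank ℝ E ∧
      (LinearMap.trace ℝ E M = Module.finrank ℝ E → M = LinearMap.id) := by
  obtain ⟨b, hb⟩ := LinearMap.BilinForm.exists_orthogonal_basis hs
  have hrepr : ∀ i x, B (b i) x = b.repr x i * B (b i) (b i) := by
    intro i x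
    conv_lhs => rw [← b.sum_repr x]
    rw [map_sum, Finset.sum_eq_single i]
    · simp
    · intro j _ hj
      have : B (b i) (b j) = 0 := hb hj.symm
      simp [this]
    · simp
  have hd : ∀ i, 0 < B (b i) (b i) := fun i => hp _ (b.ne_zero i)
  -- Positivity of the left side bounds each diagonal entry by `1`; an entry equal to `1` forces `M
  -- (b i) = b i`.
  have hdiff : ∀ i, B (M (b i) - b i) (M (b i) - b i) =
      2 * B (b i) (b i) * (1 - b.repr (M (b i)) i) := by
    intro i
    have h1 : B (M (b i)) (b i) = B (b i) (M (b i)) := hs.eq _ _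
    simp only [map_sub, LinearMap.sub_apply, hM, h1, hrepr i (M (b i))]
    ring
  have hnonneg : ∀ v, 0 ≤ B v v := fun v => by
    by_cases hv : v = 0
    · simp [hv]
    · exact (hp v hv).le
  have hle : ∀ i, b.repr (M (b i)) i ≤ 1 := by
    intro i
    have h1 := hnonneg (M (b i) - b i)
    rw [hdiff] at h1
    have := nonneg_of_mul_nonneg_right h1 (by linarith [hd i])
    linarith
  have htr : LinearMap.trace ℝ E M = ∑ i, b.repr (M (b i)) i := by
    rw [LinearMap.trace_eq_matrix_trace ℝ b]
    simp [Matrix.trace, LinearMap.toMatrix_apply]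
  have hcard : (Module.finrank ℝ E : ℝ) = ∑ _i : Fin (Module.finrank ℝ E), (1 : ℝ) := by simp
  refine ⟨?_, fun h => b.ext fun i => ?_⟩
  · rw [htr, hcard]
    exact Finset.sum_le_sum fun i _ => hle i
  · rw [htr, hcard, Finset.sum_eq_sum_iff_of_le fun i _ => hle i] at h
    have h1 := hdiff i
    rw [h i (Finset.mem_univ i), sub_self, mul_zero] at h1
    by_contra hne
    exact (hp _ (sub_ne_zero.2 hne)).ne' h1

end Trace

/-! ### Averaging an inner product over a compact group -/

section InvariantForm

open MeasureTheory

variable {E : Type*} [NormedAddCommGroup E] [NormedSpace ℝ E] [FiniteDimensional ℝ E]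
  {G : Type*} [TopologicalSpace G] [Group G] [IsTopologicalGroup G] [CompactSpace G]

/-- A continuous representation of a compact group has an invariant inner product. -/
theorem exists_invariant_form (ρ : G → E →L[ℝ] E) (hρ : Continuous ρ)
    (h1 : ρ 1 = ContinuousLinearMap.id ℝ E) (hmul : ∀ g h, ρ (g * h) = (ρ g).comp (ρ h)) :
    ∃ B : LinearMap.BilinForm ℝ E, LinearMap.IsSymm B ∧ (∀ v, v ≠ 0 → 0 < B v v) ∧
      ∀ g u v, B (ρ g u) (ρ g v) = B u v := by
  borelize G
  -- With `g⁻¹` here, replacing `u`, `v` by `ρ h u`, `ρ h v` becomes the left translation `g ↦ h⁻¹ *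
  -- g`, under which Haar measure is invariant.
  let F : E → E → G → ℝ := fun u v g =>
    inner ℝ (toEuclidean (ρ g⁻¹ u)) (toEuclidean (ρ g⁻¹ v))
  have hc : ∀ u, Continuous fun g : G => toEuclidean (ρ g⁻¹ u) := fun u =>
    toEuclidean.continuous.comp ((hρ.comp continuous_inv).clm_apply continuous_const)
  have hF : ∀ u v, Continuous (F u v) := fun u v => (hc u).inner (hc v)
  have hint : ∀ u v, Integrable (F u v) (Measure.haar : Measure G) := fun u v =>
    (hF u v).integrable_of_hasCompactSupport (HasCompactSupport.of_compactSpace _)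
  refine ⟨LinearMap.mk₂ ℝ (fun u v => ∫ g, F u v g ∂Measure.haar) ?_ ?_ ?_ ?_, ⟨?_⟩, ?_, ?_⟩
  · intro u u' v
    rw [← integral_add (hint u v) (hint u' v)]
    simp [F, inner_add_left]
  · intro c u v
    rw [smul_eq_mul, ← integral_const_mul]
    simp [F, inner_smul_left]
  · intro u v v'
    rw [← integral_add (hint u v) (hint u v')]
    simp [F, inner_add_right]
  · intro c u v
    rw [smul_eq_mul, ← integral_const_mul]
    simp [F, inner_smul_right]
  · intro u v
    simp only [LinearMap.mk₂_apply, F]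
    exact integral_congr_ae (Eventually.of_forall fun g => real_inner_comm _ _)
  · intro v hv
    simp only [LinearMap.mk₂_apply]
    refine (hF v v).integral_pos_of_hasCompactSupport_nonneg_nonzero
      (HasCompactSupport.of_compactSpace _) (fun g => real_inner_self_nonneg) (x := 1) ?_
    simp [F, h1, hv]
  · intro h u v
    simp only [LinearMap.mk₂_apply]
    rw [← integral_mul_left_eq_self (F u v) h⁻¹]
    refine integral_congr_ae (Eventually.of_forall fun g => ?_)
    simp [F, hmul]

end InvariantForm

/-! ### Lyapunov stability from a first integral -/

section Equicontinuity

variable {X : Type*} [TopologicalSpace X] [CompactSpace X] [T2Space X]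

/-- A fixed point which is a strict local maximum of a continuous first integral is stable. -/
theorem exists_open_nhd_of_first_integral {φ : ℝ → X → X} (hc : ∀ x, Continuous fun t => φ t x)
    (h0 : ∀ x, φ 0 x = x) {f : X → ℝ} (hf : Continuous f) (hinv : ∀ t x, f (φ t x) = f x) {p : X}
    (hp : ∀ᶠ x in 𝓝 p, x ≠ p → f x < f p) {U : Set X} (hU : U ∈ 𝓝 p) :
    ∃ W : Set X, IsOpen W ∧ p ∈ W ∧ ∀ x ∈ W, ∀ t, φ t x ∈ U := by
  obtain ⟨K, hK, hKc, hKU⟩ := exists_mem_nhds_isClosed_subset (inter_mem hU hp)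
  have hpK : p ∈ interior K := mem_interior_iff_mem_nhds.2 hK
  have hcl : closure (interior K) ⊆ K := closure_minimal interior_subset hKc
  have hlt : ∀ x ∈ frontier (interior K), f x < f p := by
    intro x hx
    rw [isOpen_interior.frontier_eq] at hx
    exact (hKU (hcl hx.1)).2 fun h => hx.2 (h ▸ hpK)
  obtain ⟨c, hcp, hcf⟩ : ∃ c < f p, ∀ x ∈ frontier (interior K), f x ≤ c := by
    rcases (frontier (interior K)).eq_empty_or_nonempty with h | h
    · exact ⟨f p - 1, by linarith, by simp [h]⟩
    · obtain ⟨y, hy, hmax⟩ := isClosed_frontier.isCompact.exists_isMaxOn h hf.continuousOn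
      exact ⟨f y, hlt y hy, fun x hx => hmax hx⟩
  refine ⟨interior K ∩ f ⁻¹' Ioi c, isOpen_interior.inter (isOpen_Ioi.preimage hf), ⟨hpK, hcp⟩, ?_⟩
  rintro x ⟨hxK, hxc⟩ t
  -- Along the orbit `f` keeps a value above `c`, while `f ≤ c` on the frontier: the orbit cannot
  -- cross it, and `ℝ` is connected.
  have hclopen : IsClopen {t | φ t x ∈ interior K} := by
    refine ⟨?_, isOpen_interior.preimage (hc x)⟩
    have : {t | φ t x ∈ interior K} = {t | φ t x ∈ closure (interior K)} := by
      ext s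
      refine ⟨fun h => subset_closure h, fun h => ?_⟩
      by_contra hs
      have h2 := hcf (φ s x) (by rw [isOpen_interior.frontier_eq]; exact ⟨h, hs⟩)
      rw [hinv] at h2
      exact absurd hxc (not_lt.2 h2)
    rw [this]
    exact isClosed_closure.preimage (hc x)
  have huniv := hclopen.eq_univ ⟨0, by simpa [h0] using hxK⟩
  have ht : t ∈ {t | φ t x ∈ interior K} := huniv ▸ mem_univ t
  exact (hKU (interior_subset ht)).1

end Equicontinuity

/-! ### From the identity to compact invariant sets -/

section Stability

open scoped Pointwise

/-- If a flow of group endomorphisms is stable at `1`, every compact invariant set is stable. -/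
theorem exists_open_nhd_of_isCompact {G : Type*} [TopologicalSpace G] [Group G]
    [IsTopologicalGroup G] {φ : ℝ → G → G} (hmul : ∀ t g h, φ t (g * h) = φ t g * φ t h)
    (h1 : ∀ U ∈ 𝓝 (1 : G), ∃ W : Set G, IsOpen W ∧ 1 ∈ W ∧ ∀ x ∈ W, ∀ t, φ t x ∈ U)
    {K V : Set G} (hK : IsCompact K) (hinv : ∀ x ∈ K, ∀ t, φ t x ∈ K) (hV : IsOpen V)
    (hKV : K ⊆ V) : ∃ W : Set G, IsOpen W ∧ K ⊆ W ∧ W ⊆ V ∧ ∀ x ∈ W, ∀ t, φ t x ∈ V := by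
  obtain ⟨U, hU, hUV⟩ := compact_open_separated_mul_right hK hV hKV
  obtain ⟨W, hW, h1W, hWU⟩ := h1 U hU
  -- Since `φ 0 = id` is not assumed, `W ⊆ V` is secured by intersecting with `V`.
  refine ⟨(K * W) ∩ V, hW.mul_left.inter hV,
    fun x hx => ⟨⟨x, hx, 1, h1W, mul_one x⟩, hKV hx⟩, inter_subset_right, ?_⟩
  rintro _ ⟨⟨x, hx, w, hw, rfl⟩, -⟩ t
  rw [hmul]
  exact hUV (mul_mem_mul (hinv x hx t) (hWU w hw t))

end Stability

end LinearFlow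

/-! ### The stability theorem -/

open LinearFlow Filter Topology in
theorem mainTheorem4
    {E : Type*} [NormedAddCommGroup E] [NormedSpace ℝ E] [FiniteDimensional ℝ E]
    {H : Type*} [TopologicalSpace H] (I : ModelWithCorners ℝ E H)
    {G : Type*} [TopologicalSpace G] [ChartedSpace H G] [Group G] [LieGroup I ∞ G]
    [BoundarylessManifold I G] [T2Space G] [ConnectedSpace G] [CompactSpace G]
    [LieAlgebra.IsSemisimple ℝ (GroupLieAlgebra I G)]
    (X : (g : G) → TangentSpace I g) (hX : LinearFlow.IsLinearVectorField I X)
    (φ : ℝ → G → G) (hφ : LinearFlow.IsFlow I X φ)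
    (Γ : Set G) (hΓ : LinearFlow.IsPeriodicOrbit φ Γ) :
    LinearFlow.IsStableOrbit I X Γ := by
  have : IsTopologicalGroup G := topologicalGroup_of_lieGroup I ∞
  have : IsManifold I 1 G := IsManifold.of_le (n := ∞) (by simp)
  have : CompleteSpace E := FiniteDimensional.complete ℝ E
  have hX1 : ContMDiff I I.tangent 1 (fun g : G => (⟨g, X g⟩ : TangentBundle I G)) :=
    hX.contMDiff.of_le (by simp)
  have huniq : ∀ γ : ℝ → G, IsMIntegralCurve (I := I) γ X → ∀ t, γ t = φ t (γ 0) := fun γ hγ t =>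
    congrFun (isMIntegralCurve_Ioo_eq_of_contMDiff_boundaryless (t₀ := 0) hX1 hγ (hφ (γ 0)).2
      (hφ (γ 0)).1.symm) t
  -- The flow by automorphisms supplied by `hX` agrees with `φ` by uniqueness of integral curves.
  have haut : ∀ t, IsLieGroupAutomorphism I (φ t) := by
    obtain ⟨ψ, hψ, haut⟩ := hX.exists_flow
    intro t
    have : φ t = ψ t := by
      ext g
      have := huniq _ (hψ g).2 t
      rw [(hψ g).1] at this
      exact this.symm
    exact this ▸ haut t
  have hmul : ∀ t g h, φ t (g * h) = φ t g * φ t h := by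
    intro t g h
    obtain ⟨e, he, -⟩ := haut t
    rw [← he, ← he, ← he, map_mul]
  have hcont : ∀ g, Continuous fun t => φ t g := fun g => (hφ g).2.continuous
  have h0 : ∀ g, φ 0 g = g := fun g => (hφ g).1
  obtain ⟨B, hBs, hBp, hBi⟩ := exists_invariant_form (Ad I : G → E →L[ℝ] E) continuous_Ad Ad_one
    Ad_mul
  have htr := fun g : G => trace_le_and_eq_id_of_isometry B hBs hBp (Ad I g : E →ₗ[ℝ] E) (hBi g)
  have htr1 : LinearMap.trace ℝ E (Ad I (1 : G) : E →ₗ[ℝ] E) = Module.finrank ℝ E := by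
    rw [Ad_one, ContinuousLinearMap.coe_id, LinearMap.trace_id]
  have htrc : Continuous fun g : G => LinearMap.trace ℝ E (Ad I g : E →ₗ[ℝ] E) :=
    (LinearMap.continuous_of_finiteDimensional
      ((LinearMap.trace ℝ E).comp (ContinuousLinearMap.coeLM ℝ))).comp continuous_Ad
  have hmax : ∀ᶠ g in 𝓝 (1 : G), g ≠ 1 → LinearMap.trace ℝ E (Ad I g : E →ₗ[ℝ] E) <
      LinearMap.trace ℝ E (Ad I (1 : G) : E →ₗ[ℝ] E) := by
    filter_upwards [eventually_eq_one_of_Ad_eq_id (I := I) (G := G)] with g hg hne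
    rw [htr1]
    refine lt_of_le_of_ne (htr g).1 fun h => hne (hg ?_)
    ext v
    exact DFunLike.congr_fun ((htr g).2 h) v
  obtain ⟨g, ⟨T, hT, hper⟩, rfl⟩ := hΓ
  have hcomp : IsCompact (range fun t => φ t g) := by
    have hp : Function.Periodic (fun t => φ t g) T := hper
    rw [← hp.image_Icc hT 0]
    exact isCompact_Icc.image (hcont g)
  intro V hV hΓV
  have hinv : ∀ x ∈ range fun t => φ t g, ∀ t, φ t x ∈ range fun t => φ t g := by
    rintro _ ⟨s, rfl⟩ t
    -- The group law of the flow: uniqueness applied to the time-shifted curve.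
    exact ⟨t + s, by simpa using huniq _ ((hφ g).2.comp_add s) t⟩
  obtain ⟨W, hW, hΓW, hWV, hst⟩ := exists_open_nhd_of_isCompact hmul
    (fun U hU => exists_open_nhd_of_first_integral hcont h0 htrc
      (fun t x => trace_Ad_apply_of_automorphism (haut t) x) hmax hU) hcomp hinv hV hΓV
  exact ⟨W, hW, hΓW, hWV, fun γ hγ h t _ => huniq γ hγ t ▸ hst _ h t⟩
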